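/- Let $\mathbb T$ be the unit circle and let $\omega\subsetneq\mathbb T$ be an open set (for instance an open strict arc). Write $\widehat f(n)$ ($n\in\mathbb Z$) for the Fourier coefficients of $f\in L^2(\mathbb T)$, let $P_+f=\sum_{n\ge 0}\widehat f(n)e^{inx}$ be the Riesz projector, $H^2=P_+L^2(\mathbb T)$, $|D|f=\sum_{n\in\mathbb Z}|n|\widehat f(n)e^{inx}$ and $S(t)f=\sum_{n\in\mathbb Z}e^{-|n|t}\widehat f(n)e^{inx}$ for $t\ge 0$. For $T>0$, let $\mathrm{NC}_{H^2}(\omega,T)$ be the set of those $f_0\in H^2$ for which there is a control $u\in L^2([0,T]\times\omega)$ such that the solution $$f(t)=S(t)f_0+\int_0^tS(t-s)P_+\mathbf 1_\omega u(s,\cdot)\,ds$$ of $(\partial_t+|D|)f=P_+\mathbf 1_\omega u$, $f(0)=f_0$, satisfies $f(T)=0$. As usual, $f_0\in H^2$ is identified with the holomorphic function $f_0(z)=\sum_{n\ge 0}\widehat{f_0}(n)z^n$ on the open unit disk. Theorem. Let $T>0$ and $f_0\in\mathrm{NC}_{H^2}(\omega,T)$. Then $f_0$ can be extended from the open unit disk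 to a holomorphic function, still denoted $f_0$, on $\widehat{\mathbb C}\setminus\overline\omega$, where $\widehat{\mathbb C}=\mathbb C\cup\{\infty\}$ is the Riemann sphere and $\overline\omega$ the closure of $\omega$, such that 1. $f_0(\infty)=0$, 2. $\int_{|z|>1}|f_0'(z)|^2\,dA(z)<\infty$, where $A$ is planar Lebesgue measure. -/

import Mathlib

open scoped Real Topology ENNReal

namespace HalfHeat

instance factTwoPiPos : Fact ((0 : ℝ) < 2 * π) := ⟨Real.two_pi_pos⟩

/-- The unit circle `𝕋`, in the angular coordinate: `ℝ / 2πℤ`. -/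
abbrev Torus : Type := AddCircle (2 * π)

/-- Arc length on the circle, normalized to total mass `1` (the measure `dx / 2π`). -/
noncomputable abbrev arcMeasure : MeasureTheory.Measure Torus := AddCircle.haarAddCircle

/-- The Hilbert space `L²(𝕋)`. -/
abbrev L2 : Type := MeasureTheory.Lp ℂ 2 arcMeasure

/-- A set of angles, seen as the subset `{e^{ix} : x ∈ ω}` of the complex plane. -/
def onCircle (ω : Set Torus) : Set ℂ := (fun x : Torus => (AddCircle.toCircle x : ℂ)) '' ω

/-- The Fourier multiplier with (bounded) symbol `m`:
`∑ f̂(n) e^{inx} ↦ ∑ m(n) f̂(n) e^{inx}`, the series converging in `L²(𝕋)`. -/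
noncomputable def multiplier (m : ℤ → ℂ) (f : L2) : L2 :=
  ∑' n : ℤ, (m n * fourierCoeff f n) • fourierLp 2 n

/-- The Riesz projector `P₊` on the nonnegative frequencies. -/
noncomputable def rieszProj (f : L2) : L2 :=
  multiplier (fun n => if 0 ≤ n then 1 else 0) f

/-- The Hardy space `H² = P₊ L²(𝕋)`. -/
def hardySpace : Set L2 := Set.range rieszProj

/-- The half-heat semigroup `S(t) = e^{-t|D|}`, for `t ≥ 0`. -/
noncomputable def semigroup (t : ℝ) (f : L2) : L2 :=
  multiplier (fun n => ((Real.exp (-(|(n : ℝ)| * t)) : ℝ) : ℂ)) f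

open Classical in
/-- The class in `L²(𝕋)` of a square-integrable function (and `0` if `g` is not one). -/
noncomputable def toL2 (g : Torus → ℂ) : L2 :=
  if h : MeasureTheory.MemLp g 2 arcMeasure then h.toLp g else 0

/-- `u ∈ L²([0,T] × ω)`. -/
def IsControl (ω : Set Torus) (T : ℝ) (u : ℝ × Torus → ℂ) : Prop :=
  MeasureTheory.MemLp u 2
    ((MeasureTheory.volume.restrict (Set.Icc 0 T)).prod (arcMeasure.restrict ω))

/-- The (mild) solution at time `t`, given by Duhamel's formula, of the `H²` control system
`(∂ₜ + |D|) f = P₊ 1_ω u`, `f(0) = f₀`. For a control `u` on `[0,T] × ω`, almost every slice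
`1_ω u(s, ·)`, `s ∈ [0,T]`, is square-integrable, and `t` ranges over `[0,T]`. -/
noncomputable def solution (ω : Set Torus) (f₀ : L2) (u : ℝ × Torus → ℂ) (t : ℝ) : L2 :=
  semigroup t f₀ +
    ∫ s in (0 : ℝ)..t, semigroup (t - s) (rieszProj (toL2 (ω.indicator fun x => u (s, x))))

/-- The set of `f₀ ∈ H²` that are steerable to `0` in `H²` from `ω` in time `T`. -/
def nullControllable (ω : Set Torus) (T : ℝ) : Set L2 :=
  {f₀ | f₀ ∈ hardySpace ∧ ∃ u : ℝ × Torus → ℂ, IsControl ω T u ∧ solution ω f₀ u T = 0}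

/-- The holomorphic function `z ↦ ∑_{n ≥ 0} f̂(n) zⁿ` on the unit disk, with which an element `f`
of `H²` is identified. -/
noncomputable def onDisk (f : L2) (z : ℂ) : ℂ := ∑' n : ℕ, fourierCoeff f (n : ℤ) * z ^ n

/-- The chart `w ↦ 1/w` of the Riemann sphere around `∞`. -/
noncomputable def chartAtInfty (w : ℂ) : OnePoint ℂ :=
  if w = 0 then OnePoint.infty else ((w⁻¹ : ℂ) : OnePoint ℂ)

/-- `F` is holomorphic on the open subset `U` of the Riemann sphere `ℂ ∪ {∞}`: it is complex
differentiable in the chart `z` at the finite points of `U`, and in the chart `1/z` at `∞` in case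
`∞ ∈ U`. -/
def HolomorphicOnSphere (F : OnePoint ℂ → ℂ) (U : Set (OnePoint ℂ)) : Prop :=
  (∀ z : ℂ, (z : OnePoint ℂ) ∈ U → DifferentiableAt ℂ (fun w : ℂ => F (w : OnePoint ℂ)) z) ∧
  (OnePoint.infty ∈ U → DifferentiableAt ℂ (fun w : ℂ => F (chartAtInfty w)) 0)

end HalfHeat

/-!
Write `f₀` for a state steered to `0` by the control `u`, extended by `0` off `ω`. Taking Fourier
coefficients in Duhamel's formula at time `T` gives, for `n ≥ 0`,
`f̂₀(n) = -∫∫ u(s,x) p(s,x)⁻ⁿ`, where `p(s,x) = e^{-s} e^{ix}`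
(`fourierCoeff_eq_of_solution_eq_zero`). Summing the geometric series, `f₀` coincides near `0` with
the Cauchy transform `G(z) = ∫∫ u p / (z - p)` (`controlTransform`), which is holomorphic off the
compact set `K` of the points `p(s,x)`, `0 ≤ s ≤ T`, `x ∈ ω̄`, and vanishes at infinity. The set `K`
lies in the closed disk and meets the unit circle only in `ω̄`, and the open disk minus `K` is
star-shaped about `0`, so that `f₀ = G` there by the identity theorem
(`IsControl.eqOn_onDisk_controlTransform`). Hence `f₀` in the disk and `G` outside it fit together
to one holomorphic function on the sphere minus `ω̄`.

Outside the disk `G(z) = ∑ aₙ z^{-n-1}` with `aₙ = ∫∫ u p^{n+1}`, and by Parseval's identity on the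
circles `|z| = r > 1` the Dirichlet integral of `G` there is at most `π ∑ (n+1) |aₙ|²`
(`lintegral_sq_laurent_lt_top`). The conjugates of the functions `p^{n+1}` are orthogonal in
`L²([0,T] × 𝕋)` and have squared norm at most `1 / (2(n+1))`, so this sum is finite by Bessel's
inequality (`IsControl.summable_moments`).
-/

open scoped Real Topology ENNReal

namespace HalfHeat
open MeasureTheory Set Filter

/-! ### Fourier multipliers on `L²(𝕋)` -/

theorem hasSum_multiplier {m : ℤ → ℂ} (hm : ∀ n, ‖m n‖ ≤ 1) (f : L2) :
    HasSum (fun n : ℤ => (m n * fourierCoeff f n) • (fourierLp 2 n : L2)) (multiplier m f) := by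
  have hmem : Memℓp (fun n : ℤ => m n * fourierCoeff f n) 2 := by
    refine memℓp_gen ?_
    refine (hasSum_sq_fourierCoeff (T := 2 * π) f).summable.of_nonneg_of_le (fun n => by positivity) fun n => ?_
    rw [ENNReal.toReal_ofNat, Real.rpow_ofNat, norm_mul, mul_pow]
    exact mul_le_of_le_one_left (by positivity) (pow_le_one₀ (norm_nonneg _) (hm n))
  have h := HilbertBasis.hasSum_repr_symm (fourierBasis (T := 2 * π)) ⟨_, hmem⟩
  rw [coe_fourierBasis] at h
  exact h.summable.hasSum

theorem fourierCoeff_eq_inner (f : L2) (n : ℤ) :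
    fourierCoeff f n = inner ℂ (fourierLp 2 n : L2) f := by
  rw [← fourierBasis_repr, HilbertBasis.repr_apply_apply, coe_fourierBasis]

theorem fourierCoeff_multiplier {m : ℤ → ℂ} (hm : ∀ n, ‖m n‖ ≤ 1) (f : L2) (n : ℤ) :
    fourierCoeff (multiplier m f) n = m n * fourierCoeff f n := by
  rw [fourierCoeff_eq_inner]
  have h := (hasSum_multiplier hm f).mapL (innerSL ℂ (fourierLp 2 n : L2))
  refine h.unique ?_
  refine (hasSum_ite_eq n (m n * fourierCoeff f n)).congr_fun ?_
  intro k
  rw [innerSL_apply_apply, inner_smul_right, orthonormal_iff_ite.mp orthonormal_fourier]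
  by_cases hk : k = n
  · simp [hk]
  · simp [hk, Ne.symm hk]

theorem norm_multiplier_le {m : ℤ → ℂ} (hm : ∀ n, ‖m n‖ ≤ 1) (f : L2) :
    ‖multiplier m f‖ ≤ ‖f‖ := by
  rw [← fourierBasis.repr.norm_map (multiplier m f), ← fourierBasis.repr.norm_map f]
  refine lp.norm_mono (by norm_num) fun n => ?_
  rw [fourierBasis_repr, fourierBasis_repr, fourierCoeff_multiplier hm, norm_mul]
  exact mul_le_of_le_one_left (norm_nonneg _) (hm n)

theorem norm_rieszSymbol_le (n : ℤ) : ‖(if 0 ≤ n then 1 else 0 : ℂ)‖ ≤ 1 := by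
  split_ifs <;> simp

theorem norm_heatSymbol_le {t : ℝ} (ht : 0 ≤ t) (n : ℤ) :
    ‖((Real.exp (-(|(n : ℝ)| * t)) : ℝ) : ℂ)‖ ≤ 1 := by
  rw [Complex.norm_real, Real.norm_of_nonneg (Real.exp_nonneg _)]
  exact Real.exp_le_one_iff.mpr (neg_nonpos.mpr (by positivity))

theorem norm_semigroup_rieszProj_le {t : ℝ} (ht : 0 ≤ t) (f : L2) :
    ‖semigroup t (rieszProj f)‖ ≤ ‖f‖ :=
  (norm_multiplier_le (norm_heatSymbol_le ht) _).trans (norm_multiplier_le norm_rieszSymbol_le _)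

theorem fourierCoeff_semigroup {t : ℝ} (ht : 0 ≤ t) (f : L2) (n : ℕ) :
    fourierCoeff (semigroup t f) (n : ℤ) = Real.exp (-(n * t)) * fourierCoeff f (n : ℤ) := by
  rw [semigroup, fourierCoeff_multiplier (norm_heatSymbol_le ht)]
  simp

theorem fourierCoeff_rieszProj (f : L2) (n : ℕ) :
    fourierCoeff (rieszProj f) (n : ℤ) = fourierCoeff f (n : ℤ) := by
  rw [rieszProj, fourierCoeff_multiplier norm_rieszSymbol_le]
  simp

theorem norm_fourierCoeff_le (f : L2) (n : ℤ) : ‖fourierCoeff f n‖ ≤ ‖f‖ := by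
  rw [fourierCoeff_eq_inner]
  refine (norm_inner_le_norm _ _).trans ?_
  rw [orthonormal_fourier.1 n, one_mul]

/-! ### The control as a function on `[0,T] × 𝕋` -/

/-- The product of Lebesgue measure on `[0,T]` and normalized arc length on `𝕋`. -/
noncomputable abbrev cylinderMeasure (T : ℝ) : Measure (ℝ × Torus) :=
  (volume.restrict (Icc 0 T)).prod arcMeasure

/-- The control `u`, extended by `0` to the times-angles `(s, x)` with `x ∉ ω`. -/
noncomputable def extendControl (ω : Set Torus) (u : ℝ × Torus → ℂ) (p : ℝ × Torus) : ℂ :=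
  ω.indicator (fun x => u (p.1, x)) p.2

theorem IsControl.memLp_extendControl {ω : Set Torus} (hω : IsOpen ω) {T : ℝ}
    {u : ℝ × Torus → ℂ} (hu : IsControl ω T u) :
    MemLp (extendControl ω u) 2 (cylinderMeasure T) := by
  have hμ : (volume.restrict (Icc 0 T)).prod (arcMeasure.restrict ω)
      = (cylinderMeasure T).restrict (univ ×ˢ ω) := by
    rw [cylinderMeasure, ← Measure.prod_restrict, Measure.restrict_univ]
  have hext : extendControl ω u = (univ ×ˢ ω).indicator u := by
    ext ⟨s, x⟩
    by_cases hx : x ∈ ω <;> simp [extendControl, hx]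
  rw [IsControl, hμ] at hu
  rw [hext]
  exact (memLp_indicator_iff_restrict (MeasurableSet.univ.prod hω.measurableSet)).mpr hu

theorem IsControl.ae_memLp_slice {ω : Set Torus} (hω : IsOpen ω) {T : ℝ}
    {u : ℝ × Torus → ℂ} (hu : IsControl ω T u) :
    ∀ᵐ s ∂volume.restrict (Icc 0 T), MemLp (ω.indicator fun x => u (s, x)) 2 arcMeasure := by
  have h := hu.memLp_extendControl hω
  have h2 := (memLp_two_iff_integrable_sq_norm h.1).mp h
  filter_upwards [h.1.prodMk_left, h2.prod_right_ae] with s hs1 hs2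
  exact (memLp_two_iff_integrable_sq_norm hs1).mpr hs2

theorem fourierCoeff_toL2 {g : Torus → ℂ} (hg : MemLp g 2 arcMeasure) (n : ℤ) :
    fourierCoeff (toL2 g) n = fourierCoeff g n := by
  rw [toL2, dif_pos hg]
  exact integral_congr_ae (hg.coeFn_toLp.mono fun x hx => by simp only [hx])

theorem norm_toLp_sq {α : Type*} [MeasurableSpace α] {μ : Measure α} {g : α → ℂ}
    (hg : MemLp g 2 μ) : ‖hg.toLp g‖ ^ 2 = ∫ x, ‖g x‖ ^ 2 ∂μ := by
  rw [← @inner_self_eq_norm_sq ℂ, L2.inner_def, ← integral_re (L2.integrable_inner _ _)]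
  refine integral_congr_ae (hg.coeFn_toLp.mono fun x hx => ?_)
  simp only [hx, inner_self_eq_norm_sq]

theorem norm_toL2_sq {g : Torus → ℂ} (hg : MemLp g 2 arcMeasure) :
    ‖toL2 g‖ ^ 2 = ∫ x, ‖g x‖ ^ 2 ∂arcMeasure := by
  rw [toL2, dif_pos hg, norm_toLp_sq]

theorem aestronglyMeasurable_fourierCoeff_slice {ω : Set Torus} (hω : IsOpen ω) {T : ℝ}
    {u : ℝ × Torus → ℂ} (hu : IsControl ω T u) (n : ℤ) :
    AEStronglyMeasurable (fun s => fourierCoeff (toL2 (ω.indicator fun x => u (s, x))) n)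
      (volume.restrict (Icc 0 T)) := by
  have h : AEStronglyMeasurable (fun p : ℝ × Torus => fourier (-n) p.2 • extendControl ω u p)
      (cylinderMeasure T) :=
    ((map_continuous (fourier (-n))).comp continuous_snd).aestronglyMeasurable.smul
      (hu.memLp_extendControl hω).1
  refine h.integral_prod_right'.congr ?_
  filter_upwards [hu.ae_memLp_slice hω] with s hs
  rw [fourierCoeff_toL2 hs]
  rfl

/-- The integrand in Duhamel's formula is Bochner integrable in `L²(𝕋)`: it is measurable as an
a.e. limit of finite Fourier sums, and its norm is at most that of the slice of the control. -/
theorem IsControl.integrable_duhamel {ω : Set Torus} (hω : IsOpen ω) {T : ℝ}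
    {u : ℝ × Torus → ℂ} (hu : IsControl ω T u) :
    Integrable (fun s => semigroup (T - s) (rieszProj (toL2 (ω.indicator fun x => u (s, x)))))
      (volume.restrict (Icc 0 T)) := by
  have hIcc : ∀ᵐ s ∂volume.restrict (Icc 0 T), s ∈ Icc 0 T := ae_restrict_mem measurableSet_Icc
  have h := hu.memLp_extendControl hω
  have h2 := (memLp_two_iff_integrable_sq_norm h.1).mp h
  have hbound : Integrable (fun s => 1 + ∫ x, ‖extendControl ω u (s, x)‖ ^ 2 ∂arcMeasure)
      (volume.restrict (Icc 0 T)) :=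
    (integrable_const 1).add h2.integral_prod_left
  refine hbound.mono' ?_ ?_
  · -- The finite partial sums of the Fourier series of the integrand.
    let S : Finset ℤ → ℝ → L2 := fun A s => ∑ n ∈ A,
      (((Real.exp (-(|(n : ℝ)| * (T - s))) : ℝ) : ℂ) * ((if 0 ≤ n then 1 else 0) *
        fourierCoeff (toL2 (ω.indicator fun x => u (s, x))) n)) • (fourierLp 2 n : L2)
    refine aestronglyMeasurable_of_tendsto_ae (u := atTop) (f := S) (fun A => ?_) ?_
    · refine Finset.aestronglyMeasurable_fun_sum A fun n _ => ?_
      refine AEStronglyMeasurable.smul_const (AEStronglyMeasurable.mul ?_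
        ((aestronglyMeasurable_fourierCoeff_slice hω hu n).const_mul _)) _
      exact Continuous.aestronglyMeasurable (by fun_prop)
    · filter_upwards [hIcc] with s hs
      have hsum := hasSum_multiplier (norm_heatSymbol_le (sub_nonneg.mpr hs.2))
        (rieszProj (toL2 (ω.indicator fun x => u (s, x))))
      simp only [rieszProj, fourierCoeff_multiplier norm_rieszSymbol_le] at hsum
      exact hsum
  · filter_upwards [hIcc, hu.ae_memLp_slice hω] with s hs hmem
    refine (norm_semigroup_rieszProj_le (sub_nonneg.mpr hs.2) _).trans ?_
    have hsq : ‖toL2 (ω.indicator fun x => u (s, x))‖ ^ 2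
        = ∫ x, ‖extendControl ω u (s, x)‖ ^ 2 ∂arcMeasure := norm_toL2_sq hmem
    rw [← hsq]
    nlinarith [sq_nonneg (‖toL2 (ω.indicator fun x => u (s, x))‖ - 1),
      norm_nonneg (toL2 (ω.indicator fun x => u (s, x)))]

/-! ### Cauchy transforms -/

section Cauchy
variable {α : Type*} [MeasurableSpace α] {μ : Measure α}

/-- A Cauchy transform `z ↦ ∫ v / (z - p) dμ` is holomorphic off any closed set that carries the
poles `p` on the support of the density `v`. -/
theorem differentiableOn_cauchyTransform {v p : α → ℂ} (hv : Integrable v μ)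
    (hp : AEStronglyMeasurable p μ) {K : Set ℂ} (hK : IsClosed K)
    (hvK : ∀ᵐ a ∂μ, v a ≠ 0 → p a ∈ K) :
    DifferentiableOn ℂ (fun z => ∫ a, v a / (z - p a) ∂μ) Kᶜ := by
  intro z₀ hz₀
  obtain ⟨ε, hε, hball⟩ := Metric.isOpen_iff.mp hK.isOpen_compl z₀ hz₀
  -- On half of the ball the denominators stay away from `0`, which dominates the derivatives.
  have hdist : ∀ z ∈ Metric.ball z₀ (ε / 2), ∀ w ∈ K, ε / 2 ≤ ‖z - w‖ := by
    intro z hz w hw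
    by_contra! hlt
    refine hball (?_ : w ∈ Metric.ball z₀ ε) hw
    rw [Metric.mem_ball] at hz ⊢
    rw [← dist_eq_norm, dist_comm] at hlt
    linarith [dist_triangle w z z₀]
  have hmeas : ∀ z : ℂ, AEStronglyMeasurable (fun a => v a / (z - p a)) μ := fun z =>
    (hv.1.aemeasurable.div (hp.aemeasurable.const_sub z)).aestronglyMeasurable
  have hz₀' : z₀ ∈ Metric.ball z₀ (ε / 2) := Metric.mem_ball_self (by positivity)
  refine (hasDerivAt_integral_of_dominated_loc_of_deriv_le
    (F' := fun z a => -(v a / (z - p a) ^ 2)) (bound := fun a => ‖v a‖ * ((ε / 2) ^ 2)⁻¹)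
    (Metric.ball_mem_nhds z₀ (half_pos hε)) (Eventually.of_forall hmeas) ?_ ?_ ?_
    (hv.norm.mul_const _) ?_).2.differentiableAt.differentiableWithinAt
  · refine (hv.norm.mul_const (ε / 2)⁻¹).mono' (hmeas z₀) ?_
    filter_upwards [hvK] with a ha
    by_cases h0 : v a = 0
    · simp [h0]
    · rw [norm_div, div_eq_mul_inv]
      gcongr
      exact hdist z₀ hz₀' _ (ha h0)
  · exact (hv.1.aemeasurable.div ((hp.aemeasurable.const_sub z₀).pow_const 2)).neg.aestronglyMeasurable
  · filter_upwards [hvK] with a ha z hz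
    by_cases h0 : v a = 0
    · simp [h0]
    · rw [norm_neg, norm_div, norm_pow, div_eq_mul_inv]
      gcongr
      exact hdist z hz _ (ha h0)
  · filter_upwards [hvK] with a ha z hz
    by_cases h0 : v a = 0
    · simpa [h0] using hasDerivAt_const z (0 : ℂ)
    · have hne : z - p a ≠ 0 := by
        rw [← norm_pos_iff]
        exact (half_pos hε).trans_le (hdist z hz _ (ha h0))
      refine ((hasDerivAt_const z (v a)).div ((hasDerivAt_id z).sub_const (p a)) hne).congr_deriv ?_
      rw [zero_mul, zero_sub, mul_one, neg_div, id]

theorem integrable_mul_pow {v g : α → ℂ} (hv : Integrable v μ) (hg : AEStronglyMeasurable g μ)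
    {c : ℝ} (hgc : ∀ᵐ a ∂μ, ‖g a‖ ≤ c) (n : ℕ) : Integrable (fun a => v a * g a ^ n) μ := by
  refine (hv.norm.mul_const (c ^ n)).mono' (hv.1.mul (hg.pow n)) ?_
  filter_upwards [hgc] with a ha
  rw [norm_mul, norm_pow]
  gcongr

theorem norm_integral_mul_pow_le {v g : α → ℂ} (hv : Integrable v μ)
    {c : ℝ} (hgc : ∀ᵐ a ∂μ, ‖g a‖ ≤ c) (n : ℕ) :
    ‖∫ a, v a * g a ^ n ∂μ‖ ≤ (∫ a, ‖v a‖ ∂μ) * c ^ n := by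
  rw [← integral_mul_const (μ := μ)]
  refine norm_integral_le_of_norm_le (hv.norm.mul_const _) ?_
  filter_upwards [hgc] with a ha
  rw [norm_mul, norm_pow]
  gcongr

/-- Integrating the geometric series `v / (1 - g w) = ∑ v gⁿ wⁿ` term by term. -/
theorem hasSum_integral_geometric {v g : α → ℂ} (hv : Integrable v μ)
    (hg : AEStronglyMeasurable g μ) {c : ℝ} (hc : 0 ≤ c) (hgc : ∀ᵐ a ∂μ, ‖g a‖ ≤ c)
    {w : ℂ} (hw : c * ‖w‖ < 1) :
    HasSum (fun n : ℕ => (∫ a, v a * g a ^ n ∂μ) * w ^ n) (∫ a, v a / (1 - g a * w) ∂μ) := by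
  have h := hasSum_integral_of_summable_integral_norm
    (E := ℂ) (F := fun (n : ℕ) a => v a * g a ^ n * w ^ n) (μ := μ)
    (fun n => (integrable_mul_pow hv hg hgc n).mul_const _) ?_
  · simp only [integral_mul_const] at h
    suffices heq : ∫ a, ∑' n : ℕ, v a * g a ^ n * w ^ n ∂μ = ∫ a, v a / (1 - g a * w) ∂μ from
      heq ▸ h
    refine integral_congr_ae ?_
    filter_upwards [hgc] with a ha
    have hlt : ‖g a * w‖ < 1 := by
      rw [norm_mul]
      exact (mul_le_mul_of_nonneg_right ha (norm_nonneg w)).trans_lt hw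
    simp only [mul_assoc, ← mul_pow]
    rw [tsum_mul_left, tsum_geometric_of_norm_lt_one hlt, div_eq_mul_inv]
  · refine ((summable_geometric_of_lt_one (by positivity) hw).mul_left (∫ a, ‖v a‖ ∂μ)).of_nonneg_of_le
      (fun n => integral_nonneg fun a => norm_nonneg _) fun n => ?_
    rw [← integral_mul_const]
    refine integral_mono_ae ((integrable_mul_pow hv hg hgc n).mul_const _).norm (hv.norm.mul_const _) ?_
    filter_upwards [hgc] with a ha
    rw [norm_mul, norm_mul, norm_pow, norm_pow, mul_assoc, ← mul_pow]
    gcongr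

end Cauchy

/-! ### Power series with bounded coefficients -/

theorem differentiableOn_tsum_mul_pow {c : ℕ → ℂ} {C : ℝ} (hc : ∀ n, ‖c n‖ ≤ C) :
    DifferentiableOn ℂ (fun z : ℂ => ∑' n : ℕ, c n * z ^ n) (Metric.ball 0 1) := by
  intro z hz
  rw [mem_ball_zero_iff] at hz
  obtain ⟨ρ, hzρ, hρ⟩ := exists_between hz
  have hρ0 : 0 ≤ ρ := (norm_nonneg z).trans hzρ.le
  refine ((Complex.differentiableOn_tsum_of_summable_norm
    ((summable_geometric_of_lt_one hρ0 hρ).mul_left C) (fun n => by fun_prop) Metric.isOpen_ball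
    fun n w hw => ?_).differentiableAt
      (Metric.isOpen_ball.mem_nhds (mem_ball_zero_iff.mpr hzρ))).differentiableWithinAt
  rw [mem_ball_zero_iff] at hw
  rw [norm_mul, norm_pow]
  have hC : 0 ≤ C := (norm_nonneg _).trans (hc 0)
  gcongr
  exact hc n

/-- Term by term differentiation of a Laurent series at infinity. -/
theorem hasSum_deriv_laurent {a : ℕ → ℂ} {C : ℝ} (ha : ∀ n, ‖a n‖ ≤ C) {G : ℂ → ℂ}
    (hG : ∀ z : ℂ, 1 < ‖z‖ → HasSum (fun n : ℕ => a n * (z⁻¹) ^ (n + 1)) (G z)) {z : ℂ}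
    (hz : 1 < ‖z‖) :
    HasSum (fun n : ℕ => -((n + 1) * a n) * (z⁻¹) ^ (n + 2)) (deriv G z) := by
  -- The series converges normally only on `|w| > R` with `R > 1`.
  obtain ⟨R, hR, hRz⟩ := exists_between hz
  have hR0 : 0 < R := one_pos.trans hR
  let U : Set ℂ := {w | R < ‖w‖}
  have hU : IsOpen U := isOpen_lt continuous_const continuous_norm
  have hne : ∀ w ∈ U, w ≠ 0 := fun w hw => norm_pos_iff.mp (hR0.trans hw)
  have hC : 0 ≤ C := (norm_nonneg _).trans (ha 0)
  have hsum : Summable fun n : ℕ => C * (R⁻¹) ^ (n + 1) :=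
    ((summable_nat_add_iff 1).mpr (summable_geometric_of_lt_one (by positivity)
      (inv_lt_one_of_one_lt₀ hR))).mul_left C
  have hterm : ∀ (n : ℕ), ∀ w ∈ U, HasDerivAt (fun w : ℂ => a n * (w⁻¹) ^ (n + 1))
      (-((n + 1) * a n) * (w⁻¹) ^ (n + 2)) w := by
    intro n w hw
    refine (((hasDerivAt_inv (hne w hw)).pow (n + 1)).const_mul (a n)).congr_deriv ?_
    rw [Nat.add_sub_cancel, ← inv_pow]
    push_cast
    ring
  have h := Complex.hasSum_deriv_of_summable_norm (F := fun n w => a n * (w⁻¹) ^ (n + 1)) hsum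
    (fun n w hw => (hterm n w hw).differentiableAt.differentiableWithinAt) hU
    (fun n w hw => ?_) (show z ∈ U from hRz)
  · have heq : G =ᶠ[𝓝 z] fun w => ∑' n : ℕ, a n * (w⁻¹) ^ (n + 1) := by
      filter_upwards [hU.mem_nhds (show z ∈ U from hRz)] with w hw
      exact (hG w (hR.trans hw)).tsum_eq.symm
    rw [heq.deriv_eq]
    exact h.congr_fun fun n => (hterm n z hRz).deriv.symm
  · rw [norm_mul, norm_pow, norm_inv]
    have : R ≤ ‖w‖ := le_of_lt hw
    gcongr
    exact ha n

/-! ### The Dirichlet integral of a Laurent series at infinity -/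

theorem lintegral_sq_sum_fourier (b : ℕ → ℂ) {e : ℕ → ℤ} (he : Function.Injective e)
    (A : Finset ℕ) :
    ∫⁻ x, ‖∑ n ∈ A, b n * (fourier (e n) x : ℂ)‖ₑ ^ 2 ∂arcMeasure = ∑ n ∈ A, ‖b n‖ₑ ^ 2 := by
  let S : C(Torus, ℂ) := ∑ n ∈ A, b n • fourier (e n)
  have hS : ContinuousMap.toLp 2 arcMeasure ℂ S = ∑ n ∈ A, b n • (fourierLp 2 (e n) : L2) := by
    simp only [S, map_sum, map_smul]
  have hcoe : ∀ x, S x = ∑ n ∈ A, b n * (fourier (e n) x : ℂ) := fun x => by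
    simp [S, ContinuousMap.sum_apply]
  have h1 : ‖ContinuousMap.toLp 2 arcMeasure ℂ S‖ₑ ^ 2
      = ∫⁻ x, ‖∑ n ∈ A, b n * (fourier (e n) x : ℂ)‖ₑ ^ 2 ∂arcMeasure := by
    rw [Lp.enorm_def, eLpNorm_congr_ae (ContinuousMap.coeFn_toLp arcMeasure S)]
    have := eLpNorm_nnreal_pow_eq_lintegral (f := S) (μ := arcMeasure) (two_ne_zero (α := NNReal))
    simpa [hcoe] using this
  have h2 : ‖ContinuousMap.toLp 2 arcMeasure ℂ S‖ ^ 2 = ∑ n ∈ A, ‖b n‖ ^ 2 := by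
    rw [hS, ← @inner_self_eq_norm_sq ℂ,
      show inner ℂ (∑ n ∈ A, b n • (fourierLp 2 (e n) : L2)) (∑ n ∈ A, b n • fourierLp 2 (e n))
        = ∑ n ∈ A, (starRingEnd ℂ) (b n) * b n from
        (orthonormal_fourier.comp e he).inner_sum b b A, map_sum]
    refine Finset.sum_congr rfl fun n _ => ?_
    rw [RCLike.conj_mul]
    norm_cast
  rw [← h1, ← ofReal_norm, ← ENNReal.ofReal_pow (norm_nonneg _), h2,
    ENNReal.ofReal_sum_of_nonneg fun n _ => by positivity]
  refine Finset.sum_congr rfl fun n _ => ?_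
  rw [← ofReal_norm, ENNReal.ofReal_pow (norm_nonneg _)]

/-- One half of Parseval's identity, for a pointwise convergent trigonometric series: Fatou's lemma
applied to the partial sums. -/
theorem lintegral_sq_le_of_hasSum_fourier {b : ℕ → ℂ} {e : ℕ → ℤ} (he : Function.Injective e)
    {f : Torus → ℂ} (hf : ∀ x, HasSum (fun n => b n * (fourier (e n) x : ℂ)) (f x)) :
    ∫⁻ x, ‖f x‖ₑ ^ 2 ∂arcMeasure ≤ ∑' n, ‖b n‖ₑ ^ 2 := by
  have hlim : ∀ x, ‖f x‖ₑ ^ 2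
      = liminf (fun N : ℕ => ‖∑ n ∈ Finset.range N, b n * (fourier (e n) x : ℂ)‖ₑ ^ 2) atTop := by
    intro x
    refine (Tendsto.liminf_eq ?_).symm
    exact ((ENNReal.continuous_pow 2).comp continuous_enorm).continuousAt.tendsto.comp
      (hf x).tendsto_sum_nat
  simp only [hlim]
  refine (lintegral_liminf_le' fun N => ?_).trans ?_
  · refine Continuous.aemeasurable ?_
    refine (ENNReal.continuous_pow 2).comp (continuous_enorm.comp ?_)
    fun_prop
  · simp only [lintegral_sq_sum_fourier b he]
    exact liminf_le_of_frequently_le' (Frequently.of_forall fun N => ENNReal.sum_le_tsum _)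

/-- The factor `2π` is the total mass of arc length, which `arcMeasure` normalizes to `1`. -/
theorem lintegral_polar_slice (f : Torus → ℝ≥0∞) :
    ∫⁻ θ in Ioo (-π) π, f (θ : Torus) ≤ ENNReal.ofReal (2 * π) * ∫⁻ x, f x ∂arcMeasure := by
  calc ∫⁻ θ in Ioo (-π) π, f (θ : Torus)
      ≤ ∫⁻ θ in Ioc (-π) (-π + 2 * π), f (θ : Torus) :=
        lintegral_mono_set fun θ hθ => ⟨hθ.1, by linarith [hθ.2]⟩
    _ = ENNReal.ofReal (2 * π) * ∫⁻ x, f x ∂arcMeasure := by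
        rw [AddCircle.lintegral_preimage, AddCircle.volume_eq_smul_haarAddCircle,
          lintegral_smul_measure, smul_eq_mul]

theorem polarCoord_symm_eq (r θ : ℝ) :
    Complex.polarCoord.symm (r, θ) = r * (AddCircle.toCircle (θ : Torus) : ℂ) := by
  rw [Complex.polarCoord_symm_apply, AddCircle.toCircle_apply_mk, div_self Real.two_pi_pos.ne',
    one_mul, Circle.coe_exp, Complex.exp_mul_I, Complex.ofReal_cos, Complex.ofReal_sin]

theorem lintegral_radial (n : ℕ) :
    ∫⁻ r in Ioi (1 : ℝ), ENNReal.ofReal (r * (r⁻¹ ^ (n + 2)) ^ 2)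
      = ENNReal.ofReal (1 / (2 * (n + 1))) := by
  have hexp : -(2 * (n : ℝ) + 3) < -1 := by linarith [(n.cast_nonneg : (0 : ℝ) ≤ n)]
  have hcongr : ∀ r ∈ Ioi (1 : ℝ), r * (r⁻¹ ^ (n + 2)) ^ 2 = r ^ (-(2 * (n : ℝ) + 3)) := by
    intro r hr
    have hr0 : 0 < r := one_pos.trans hr
    rw [Real.rpow_neg hr0.le, show 2 * (n : ℝ) + 3 = ((2 * n + 3 : ℕ) : ℝ) by push_cast; ring,
      Real.rpow_natCast]
    rw [inv_pow, inv_pow]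
    field_simp
    ring
  rw [setLIntegral_congr_fun measurableSet_Ioi fun r hr => by rw [hcongr r hr],
    ← ofReal_integral_eq_lintegral_ofReal (integrableOn_Ioi_rpow_of_lt hexp one_pos),
    integral_Ioi_rpow_of_lt hexp one_pos, Real.one_rpow]
  · congr 1
    have : (n : ℝ) + 1 ≠ 0 := by positivity
    rw [div_eq_div_iff (by linarith) (by positivity)]
    ring
  · filter_upwards [ae_restrict_mem measurableSet_Ioi] with r hr
    exact Real.rpow_nonneg (one_pos.trans hr).le _

/-- The integral is at most `π ∑ (n+1) |aₙ|²`: use Parseval on each circle `|z| = r`, then integrate in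
`r > 1`. -/
theorem lintegral_sq_laurent_lt_top {g : ℂ → ℂ} {a : ℕ → ℂ}
    (hg : ∀ z : ℂ, 1 < ‖z‖ → HasSum (fun n : ℕ => -((n + 1) * a n) * (z⁻¹) ^ (n + 2)) (g z))
    (ha : Summable fun n : ℕ => ((n : ℝ) + 1) * ‖a n‖ ^ 2) :
    ∫⁻ z in {z : ℂ | 1 < ‖z‖}, ‖g z‖ₑ ^ 2 < ∞ := by
  have hS : MeasurableSet {z : ℂ | 1 < ‖z‖} := measurableSet_lt measurable_const measurable_norm
  have hcircle : ∀ r : ℝ, 1 < r →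
      ∫⁻ θ in Ioo (-π) π, ‖g (Complex.polarCoord.symm (r, θ))‖ₑ ^ 2
        ≤ ENNReal.ofReal (2 * π) *
          ∑' n : ℕ, ENNReal.ofReal ((((n : ℝ) + 1) * ‖a n‖) ^ 2 * (r⁻¹ ^ (n + 2)) ^ 2) := by
    intro r hr
    have hr0 : 0 < r := one_pos.trans hr
    simp only [polarCoord_symm_eq]
    refine (lintegral_polar_slice
      fun x => ‖g (r * (AddCircle.toCircle x : ℂ))‖ₑ ^ 2).trans ?_
    gcongr
    have hinj : Function.Injective fun n : ℕ => -((n : ℤ) + 2) := fun m n h => by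
      simp only at h
      omega
    refine (lintegral_sq_le_of_hasSum_fourier (b := fun n : ℕ =>
      -((n + 1) * a n) * ((r : ℂ)⁻¹) ^ (n + 2)) hinj fun x => ?_).trans_eq ?_
    · refine (hg _ ?_).congr_fun fun n => ?_
      · rw [norm_mul, Circle.norm_coe, mul_one, Complex.norm_real, Real.norm_of_nonneg hr0.le]
        exact hr
      · rw [fourier_apply, neg_smul, AddCircle.toCircle_neg, Circle.coe_inv, mul_inv, mul_pow,
          ← mul_assoc, inv_pow (AddCircle.toCircle x : ℂ),
          show ((n : ℤ) + 2) • x = (n + 2) • x by rw [← natCast_zsmul]; push_cast; rfl,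
          AddCircle.toCircle_nsmul, Circle.coe_pow]
    · refine tsum_congr fun n => ?_
      rw [← ofReal_norm, ← ENNReal.ofReal_pow (norm_nonneg _), norm_mul, norm_neg, norm_mul,
        norm_pow, norm_inv, Complex.norm_real, Real.norm_of_nonneg hr0.le, mul_pow]
      congr 4
      exact_mod_cast Complex.norm_natCast (n + 1)
  calc ∫⁻ z in {z : ℂ | 1 < ‖z‖}, ‖g z‖ₑ ^ 2
      = ∫⁻ p in Ioi (0 : ℝ) ×ˢ Ioo (-π) π, ENNReal.ofReal p.1 •
          {z : ℂ | 1 < ‖z‖}.indicator (fun z => ‖g z‖ₑ ^ 2) (Complex.polarCoord.symm p) := by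
        rw [← lintegral_indicator hS, ← Complex.lintegral_comp_polarCoord_symm]
        rfl
    _ ≤ ∫⁻ r in Ioi (0 : ℝ), ∫⁻ θ in Ioo (-π) π, ENNReal.ofReal r •
          {z : ℂ | 1 < ‖z‖}.indicator (fun z => ‖g z‖ₑ ^ 2) (Complex.polarCoord.symm (r, θ)) := by
        rw [Measure.volume_eq_prod, ← Measure.prod_restrict]
        exact lintegral_prod_le _
    _ ≤ ∫⁻ r in Ioi (0 : ℝ), (Ioi (1 : ℝ)).indicator (fun r => ENNReal.ofReal (2 * π) *
          ∑' n : ℕ, ENNReal.ofReal ((((n : ℝ) + 1) * ‖a n‖) ^ 2) *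
            ENNReal.ofReal (r * (r⁻¹ ^ (n + 2)) ^ 2)) r := by
        refine setLIntegral_mono' measurableSet_Ioi fun r (hr : 0 < r) => ?_
        have hnorm : ∀ θ : ℝ, ‖Complex.polarCoord.symm (r, θ)‖ = r := fun θ => by
          rw [polarCoord_symm_eq, norm_mul, Circle.norm_coe, mul_one, Complex.norm_real,
            Real.norm_of_nonneg hr.le]
        by_cases h1 : 1 < r
        · simp only [indicator, mem_ofPred_eq, hnorm, h1, mem_Ioi, if_true, smul_eq_mul]
          rw [lintegral_const_mul' _ _ ENNReal.ofReal_ne_top]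
          refine (mul_le_mul_right (hcircle r h1) _).trans_eq ?_
          rw [mul_left_comm, ← ENNReal.tsum_mul_left]
          congr 1
          refine tsum_congr fun n => ?_
          rw [← ENNReal.ofReal_mul hr.le, ← ENNReal.ofReal_mul (by positivity)]
          congr 1
          ring
        · simp only [indicator, mem_ofPred_eq, hnorm, h1, mem_Ioi, if_false, smul_zero,
            lintegral_zero, le_refl]
    _ = ∫⁻ r in Ioi (1 : ℝ), ENNReal.ofReal (2 * π) *
          ∑' n : ℕ, ENNReal.ofReal ((((n : ℝ) + 1) * ‖a n‖) ^ 2) *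
            ENNReal.ofReal (r * (r⁻¹ ^ (n + 2)) ^ 2) := by
        rw [lintegral_indicator measurableSet_Ioi, Measure.restrict_restrict measurableSet_Ioi,
          inter_eq_left.mpr (Ioi_subset_Ioi zero_le_one)]
    _ = ENNReal.ofReal (2 * π) * ∑' n : ℕ, ENNReal.ofReal ((((n : ℝ) + 1) * ‖a n‖) ^ 2) *
          ENNReal.ofReal (1 / (2 * (n + 1))) := by
        rw [lintegral_const_mul' _ _ ENNReal.ofReal_ne_top, lintegral_tsum]
        · congr 1
          refine tsum_congr fun n => ?_
          rw [lintegral_const_mul' _ _ ENNReal.ofReal_ne_top, lintegral_radial]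
        · intro n
          fun_prop
    _ = ENNReal.ofReal (2 * π) * ENNReal.ofReal (∑' n : ℕ, ((n : ℝ) + 1) * ‖a n‖ ^ 2 / 2) := by
        rw [ENNReal.ofReal_tsum_of_nonneg (fun n => by positivity) (ha.div_const 2)]
        congr 1
        refine tsum_congr fun n => ?_
        rw [← ENNReal.ofReal_mul (by positivity)]
        congr 1
        field_simp
    _ < ∞ := ENNReal.mul_lt_top ENNReal.ofReal_lt_top ENNReal.ofReal_lt_top

theorem integrableOn_sq_deriv_of_laurent {G : ℂ → ℂ} {a : ℕ → ℂ} {C : ℝ} (hC : ∀ n, ‖a n‖ ≤ C)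
    (hG : ∀ z : ℂ, 1 < ‖z‖ → HasSum (fun n : ℕ => a n * (z⁻¹) ^ (n + 1)) (G z))
    (ha : Summable fun n : ℕ => ((n : ℝ) + 1) * ‖a n‖ ^ 2) :
    IntegrableOn (fun z => ‖deriv G z‖ ^ 2) {z : ℂ | 1 < ‖z‖} := by
  refine ⟨((measurable_deriv G).norm.pow_const 2).aestronglyMeasurable, ?_⟩
  have h := lintegral_sq_laurent_lt_top (fun z hz => hasSum_deriv_laurent hC hG hz) ha
  simpa [HasFiniteIntegral, enorm_pow] using h

/-! ### The poles `e^{-s} e^{ix}` -/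

/-- The point `e^{-s} e^{ix}` of the closed unit disk attached to the time-angle pair `(s, x)`. -/
noncomputable def pole (q : ℝ × Torus) : ℂ := Real.exp (-q.1) * (AddCircle.toCircle q.2 : ℂ)

theorem continuous_pole : Continuous pole := by
  have h : Continuous fun q : ℝ × Torus => (AddCircle.toCircle q.2 : ℂ) :=
    continuous_subtype_val.comp (AddCircle.continuous_toCircle.comp continuous_snd)
  unfold pole
  fun_prop

theorem norm_pole (q : ℝ × Torus) : ‖pole q‖ = Real.exp (-q.1) := by
  rw [pole, norm_mul, Circle.norm_coe, mul_one, Complex.norm_real,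
    Real.norm_of_nonneg (Real.exp_nonneg _)]

theorem pole_ne_zero (q : ℝ × Torus) : pole q ≠ 0 := by
  rw [← norm_pos_iff, norm_pole]
  exact Real.exp_pos _

theorem pole_pow (q : ℝ × Torus) (n : ℕ) :
    pole q ^ n = (Real.exp (-(n * q.1)) : ℝ) * (fourier (n : ℤ) q.2 : ℂ) := by
  rw [pole, mul_pow, ← Complex.ofReal_pow, ← Real.exp_nat_mul, mul_neg, fourier_apply,
    natCast_zsmul, AddCircle.toCircle_nsmul, Circle.coe_pow]

theorem pole_inv_pow (q : ℝ × Torus) (n : ℕ) :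
    (pole q)⁻¹ ^ n = (Real.exp (n * q.1) : ℝ) * (fourier (-(n : ℤ)) q.2 : ℂ) := by
  rw [inv_pow, pole_pow, mul_inv, ← Complex.ofReal_inv, ← Real.exp_neg, neg_neg, fourier_apply,
    fourier_apply, neg_smul, AddCircle.toCircle_neg, Circle.coe_inv]

theorem ae_mem_Icc (T : ℝ) : ∀ᵐ q ∂cylinderMeasure T, q.1 ∈ Icc 0 T :=
  Measure.quasiMeasurePreserving_fst.ae (ae_restrict_mem measurableSet_Icc)

theorem ae_norm_pole_le (T : ℝ) : ∀ᵐ q ∂cylinderMeasure T, ‖pole q‖ ≤ 1 := by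
  filter_upwards [ae_mem_Icc T] with q hq
  rw [norm_pole, Real.exp_le_one_iff, neg_nonpos]
  exact hq.1

theorem ae_norm_pole_inv_le (T : ℝ) :
    ∀ᵐ q ∂cylinderMeasure T, ‖(pole q)⁻¹‖ ≤ Real.exp T := by
  filter_upwards [ae_mem_Icc T] with q hq
  rw [norm_inv, norm_pole, ← Real.exp_neg, neg_neg, Real.exp_le_exp]
  exact hq.2

/-- The set swept out by the poles when `x` ranges over the closure of `ω`. -/
def poleSet (ω : Set Torus) (T : ℝ) : Set ℂ := pole '' (Icc 0 T ×ˢ closure ω)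

theorem isClosed_poleSet (ω : Set Torus) (T : ℝ) : IsClosed (poleSet ω T) :=
  ((isCompact_Icc.prod isClosed_closure.isCompact).image continuous_pole).isClosed

theorem mem_closure_onCircle_of_mem_poleSet {ω : Set Torus} {T : ℝ} {z : ℂ}
    (hz : z ∈ poleSet ω T) (h1 : 1 ≤ ‖z‖) : z ∈ closure (onCircle ω) := by
  obtain ⟨⟨s, x⟩, ⟨hs, hx⟩, rfl⟩ := hz
  rw [norm_pole, Real.one_le_exp_iff] at h1
  obtain rfl : s = 0 := le_antisymm (neg_nonneg.mp h1) hs.1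
  have hcont : Continuous fun x : Torus => (AddCircle.toCircle x : ℂ) :=
    continuous_subtype_val.comp AddCircle.continuous_toCircle
  have := image_closure_subset_closure_image hcont (mem_image_of_mem _ hx)
  simpa [pole, onCircle] using this

/-- Removing the poles from the open disk leaves a set that is star-shaped about `0`, since the
poles fill, on each ray, everything from radius `e^{-T}` outwards or nothing. -/
theorem starConvex_ball_diff_poleSet (ω : Set Torus) (T : ℝ) :
    StarConvex ℝ 0 (Metric.ball (0 : ℂ) 1 ∩ (poleSet ω T)ᶜ) := by
  rw [starConvex_zero_iff]
  intro z hz t ht0 ht1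
  have hz1 : ‖z‖ < 1 := mem_ball_zero_iff.mp hz.1
  refine ⟨?_, ?_⟩
  · rw [mem_ball_zero_iff, norm_smul, Real.norm_of_nonneg ht0]
    exact (mul_le_of_le_one_left (norm_nonneg z) ht1).trans_lt hz1
  · rintro ⟨⟨s, x⟩, ⟨hs, hx⟩, heq⟩
    -- If `t z` is a pole with angle `x`, then `z` is the pole with angle `x` at time `-log |z|`.
    refine hz.2 ⟨(-Real.log ‖z‖, x), ⟨⟨?_, ?_⟩, hx⟩, ?_⟩
    all_goals
      have hnorm : Real.exp (-s) = t * ‖z‖ := by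
        rw [← norm_pole (s, x), heq, norm_smul, Real.norm_of_nonneg ht0]
      have htz : 0 < t * ‖z‖ := hnorm ▸ Real.exp_pos _
      have ht : 0 < t := pos_of_mul_pos_left htz (norm_nonneg z)
      have hz0 : 0 < ‖z‖ := pos_of_mul_pos_right htz ht0
    · exact neg_nonneg.mpr (Real.log_nonpos hz0.le hz1.le)
    · rw [neg_le, ← Real.exp_le_exp, Real.exp_log hz0]
      calc Real.exp (-T) ≤ Real.exp (-s) := Real.exp_le_exp.mpr (neg_le_neg hs.2)
        _ = t * ‖z‖ := hnorm
        _ ≤ ‖z‖ := mul_le_of_le_one_left hz0.le ht1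
    · have htc : (t : ℂ) ≠ 0 := Complex.ofReal_ne_zero.mpr ht.ne'
      refine mul_left_cancel₀ htc ?_
      rw [pole, neg_neg, Real.exp_log hz0, ← mul_assoc, ← Complex.ofReal_mul, ← hnorm]
      simpa [pole] using heq

theorem zero_notMem_poleSet (ω : Set Torus) (T : ℝ) : (0 : ℂ) ∉ poleSet ω T := by
  rintro ⟨q, -, hq⟩
  exact pole_ne_zero q hq

theorem extendControl_ne_zero {ω : Set Torus} {u : ℝ × Torus → ℂ} {q : ℝ × Torus}
    (h : extendControl ω u q ≠ 0) : q.2 ∈ ω := by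
  by_contra hx
  exact h (indicator_of_notMem hx _)

/-! ### Fourier coefficients of a controllable state -/

theorem IsControl.integrable_extendControl {ω : Set Torus} (hω : IsOpen ω) {T : ℝ}
    {u : ℝ × Torus → ℂ} (hu : IsControl ω T u) :
    Integrable (extendControl ω u) (cylinderMeasure T) :=
  (hu.memLp_extendControl hω).integrable (by norm_num)

/-- If `u` steers `f₀` to `0`, then `f̂₀(n) = -∫∫ u(s,x) e^{ns} e^{-inx}`. -/
theorem fourierCoeff_eq_of_solution_eq_zero {ω : Set Torus} (hω : IsOpen ω) {T : ℝ} (hT : 0 < T)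
    {f₀ : L2} {u : ℝ × Torus → ℂ} (hu : IsControl ω T u) (hsol : solution ω f₀ u T = 0) (n : ℕ) :
    fourierCoeff f₀ (n : ℤ) = -∫ q, extendControl ω u q * (pole q)⁻¹ ^ n ∂cylinderMeasure T := by
  set U : ℝ → L2 := fun s => toL2 (ω.indicator fun x => u (s, x)) with hU
  have hint := hu.integrable_duhamel hω
  have hII : IntervalIntegrable (fun s => semigroup (T - s) (rieszProj (U s))) volume 0 T :=
    (intervalIntegrable_iff_integrableOn_Icc_of_le hT.le).mpr hint
  have hcoef : fourierCoeff (semigroup T f₀) (n : ℤ)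
      + ∫ s in (0 : ℝ)..T, fourierCoeff (semigroup (T - s) (rieszProj (U s))) (n : ℤ) = 0 := by
    have h := congrArg (innerSL ℂ (fourierLp 2 (n : ℤ) : L2)) hsol
    rw [solution, map_add, ← ContinuousLinearMap.intervalIntegral_comp_comm _ hII, map_zero] at h
    simpa only [innerSL_apply_apply, ← fourierCoeff_eq_inner] using h
  have hprod : ∫ q, extendControl ω u q * (pole q)⁻¹ ^ n ∂cylinderMeasure T
      = Real.exp (n * T) *
        ∫ s in (0 : ℝ)..T, fourierCoeff (semigroup (T - s) (rieszProj (U s))) (n : ℤ) := by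
    rw [intervalIntegral.integral_of_le hT.le, ← integral_Icc_eq_integral_Ioc,
      integral_prod _ (integrable_mul_pow (g := fun q => (pole q)⁻¹) (hu.integrable_extendControl hω)
        (continuous_pole.inv₀ pole_ne_zero).aestronglyMeasurable (ae_norm_pole_inv_le T) n),
      ← integral_const_mul]
    refine integral_congr_ae ?_
    filter_upwards [ae_restrict_mem measurableSet_Icc, hu.ae_memLp_slice hω] with s hs hmem
    rw [fourierCoeff_semigroup (sub_nonneg.mpr hs.2), fourierCoeff_rieszProj, hU,
      fourierCoeff_toL2 hmem, ← mul_assoc, ← Complex.ofReal_mul, ← Real.exp_add, fourierCoeff,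
      ← integral_const_mul]
    refine integral_congr_ae (Eventually.of_forall fun x => ?_)
    simp only [pole_inv_pow, smul_eq_mul, extendControl]
    rw [show n * T + -(n * (T - s)) = n * s by ring]
    ring
  rw [fourierCoeff_semigroup hT.le] at hcoef
  rw [hprod, eq_neg_iff_add_eq_zero]
  have h := congrArg (((Real.exp (n * T) : ℝ) : ℂ) * ·) hcoef
  simp only [mul_add, mul_zero, ← mul_assoc, ← Complex.ofReal_mul, ← Real.exp_add] at h
  simpa using h

/-! ### Square-summability of the moments of the control -/

/-- Bessel's inequality for an orthogonal, not necessarily normalized, family. -/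
theorem summable_inner_sq_div_norm_sq {E : Type*} [NormedAddCommGroup E] [InnerProductSpace ℂ E]
    {v : ℕ → E} (hv : ∀ i j, i ≠ j → inner ℂ (v i) (v j) = 0) (h0 : ∀ i, v i ≠ 0) (x : E) :
    Summable fun i => ‖inner ℂ (v i) x‖ ^ 2 / ‖v i‖ ^ 2 := by
  have hon : Orthonormal ℂ fun i => ((‖v i‖⁻¹ : ℝ) : ℂ) • v i := by
    refine ⟨fun i => ?_, fun i j hij => ?_⟩
    · rw [norm_smul, Complex.norm_real, norm_inv, norm_norm,
        inv_mul_cancel₀ (norm_ne_zero_iff.mpr (h0 i))]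
    · simp only [inner_smul_left, inner_smul_right, hv i j hij, mul_zero]
  refine (hon.inner_products_summable x).congr fun i => ?_
  rw [inner_smul_left, norm_mul, mul_pow, Complex.conj_ofReal, Complex.norm_real, norm_inv,
    norm_norm, inv_pow, inv_mul_eq_div]

theorem integral_fourier_mul_fourier {m n : ℤ} (h : m ≠ n) :
    ∫ x, (fourier (-m) x : ℂ) * fourier n x ∂arcMeasure = 0 := by
  have := orthonormal_iff_ite.mp (orthonormal_fourier (T := 2 * π)) m n
  rw [if_neg h, fourierLp, fourierLp, ContinuousMap.inner_toLp] at this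
  rw [← this]
  refine integral_congr_ae (Eventually.of_forall fun x => ?_)
  simp only [fourier_neg]
  ring

theorem integral_Icc_exp_neg {c T : ℝ} (hc : 0 < c) (hT : 0 ≤ T) :
    ∫ s in Icc 0 T, Real.exp (-(c * s)) = (1 - Real.exp (-(c * T))) / c := by
  rw [integral_Icc_eq_integral_Ioc, ← intervalIntegral.integral_of_le hT]
  have hderiv : ∀ s ∈ uIcc 0 T,
      HasDerivAt (fun s => -(Real.exp (-(c * s)) / c)) (Real.exp (-(c * s))) s := by
    intro s _
    refine ((((hasDerivAt_id s).const_mul c).neg.exp).div_const c).neg.congr_deriv ?_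
    simp only [id, Pi.neg_apply]
    field_simp
  rw [intervalIntegral.integral_eq_sub_of_hasDerivAt hderiv
    (Continuous.intervalIntegrable (by fun_prop) _ _)]
  simp
  ring

/-- The functions `e^{-(n+1)s} e^{-i(n+1)x}` are orthogonal in `L²([0,T] × 𝕋)`, with squared norm
at most `1 / (2(n+1))`; so the moments of the control against them satisfy a weighted
`ℓ²`-bound. -/
theorem IsControl.summable_moments {ω : Set Torus} (hω : IsOpen ω) {T : ℝ} (hT : 0 < T)
    {u : ℝ × Torus → ℂ} (hu : IsControl ω T u) :
    Summable fun n : ℕ => ((n : ℝ) + 1) *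
      ‖∫ q, extendControl ω u q * pole q ^ (n + 1) ∂cylinderMeasure T‖ ^ 2 := by
  -- Conjugated, because the inner product is conjugate-linear in its first argument.
  let e : ℕ → ℝ × Torus → ℂ := fun n q => (starRingEnd ℂ) (pole q ^ (n + 1))
  have he : ∀ n, MemLp (e n) 2 (cylinderMeasure T) := fun n => by
    refine MemLp.of_bound (C := 1) (Continuous.aestronglyMeasurable
      (Complex.continuous_conj.comp (continuous_pole.pow _))) ?_
    filter_upwards [ae_norm_pole_le T] with q hq
    rw [RCLike.norm_conj, norm_pow]
    exact pow_le_one₀ (norm_nonneg _) hq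
  have hU := hu.memLp_extendControl hω
  have hinner : ∀ n {g : ℝ × Torus → ℂ} (hg : MemLp g 2 (cylinderMeasure T)),
      inner ℂ ((he n).toLp (e n)) (hg.toLp g)
        = ∫ q, g q * pole q ^ (n + 1) ∂cylinderMeasure T := by
    intro n g hg
    rw [L2.inner_def]
    refine integral_congr_ae ?_
    filter_upwards [(he n).coeFn_toLp, hg.coeFn_toLp] with q h1 h2
    rw [h1, h2, RCLike.inner_apply, RCLike.conj_conj]
  have horth : ∀ i j, i ≠ j → inner ℂ ((he i).toLp (e i)) ((he j).toLp (e j)) = 0 := by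
    intro i j hij
    have hne : (((j + 1 : ℕ) : ℤ)) ≠ ((i + 1 : ℕ) : ℤ) := by omega
    rw [hinner i (he j)]
    calc ∫ q, e j q * pole q ^ (i + 1) ∂cylinderMeasure T
        = ∫ q : ℝ × Torus, ((Real.exp (-(((j + 1 : ℕ) : ℝ) * q.1)) : ℂ)
            * (Real.exp (-(((i + 1 : ℕ) : ℝ) * q.1)) : ℂ))
            * ((fourier (-((j + 1 : ℕ) : ℤ)) q.2 : ℂ) * fourier ((i + 1 : ℕ) : ℤ) q.2)
            ∂cylinderMeasure T := by
          refine integral_congr_ae (Eventually.of_forall fun q => ?_)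
          simp only [e, pole_pow, map_mul, Complex.conj_ofReal, fourier_neg]
          ring
      _ = 0 := by
          rw [cylinderMeasure, integral_prod_mul (fun s : ℝ =>
            (Real.exp (-(((j + 1 : ℕ) : ℝ) * s)) : ℂ) * (Real.exp (-(((i + 1 : ℕ) : ℝ) * s)) : ℂ))
            (fun x : Torus => (fourier (-((j + 1 : ℕ) : ℤ)) x : ℂ) * fourier ((i + 1 : ℕ) : ℤ) x),
            integral_fourier_mul_fourier hne, mul_zero]
  have hnorm : ∀ n : ℕ, ‖(he n).toLp (e n)‖ ^ 2
      = (1 - Real.exp (-(2 * ((n : ℝ) + 1) * T))) / (2 * ((n : ℝ) + 1)) := by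
    intro n
    rw [norm_toLp_sq, ← integral_Icc_exp_neg (by positivity) hT.le]
    have hsq : ∀ q : ℝ × Torus, ‖e n q‖ ^ 2 = Real.exp (-(2 * ((n : ℝ) + 1) * q.1)) := by
      intro q
      rw [RCLike.norm_conj, norm_pow, norm_pole, ← pow_mul, ← Real.exp_nat_mul]
      congr 1
      push_cast
      ring
    simp only [hsq]
    rw [cylinderMeasure, integral_fun_fst (fun s : ℝ => Real.exp (-(2 * ((n : ℝ) + 1) * s)))]
    simp
  have hpos : ∀ n : ℕ, 0 < ‖(he n).toLp (e n)‖ ^ 2 := by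
    intro n
    rw [hnorm]
    have : Real.exp (-(2 * ((n : ℝ) + 1) * T)) < 1 := by
      rw [Real.exp_lt_one_iff, neg_neg_iff_pos]
      positivity
    exact div_pos (sub_pos.mpr this) (by positivity)
  refine (summable_inner_sq_div_norm_sq horth (fun n h => ?_) (hU.toLp _)).of_nonneg_of_le
    (fun n => by positivity) fun n => ?_
  · simpa [h] using hpos n
  · rw [hinner n hU, le_div_iff₀ (hpos n), mul_right_comm]
    refine mul_le_of_le_one_left (by positivity) ?_
    rw [hnorm, mul_div_assoc', div_le_one (by positivity)]
    nlinarith [Real.exp_pos (-(2 * ((n : ℝ) + 1) * T)), (n.cast_nonneg : (0 : ℝ) ≤ n)]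

/-! ### The holomorphic extension -/

/-- The Cauchy transform `z ↦ ∫∫ u(s,x) e^{-s+ix} / (z - e^{-s+ix})` of the control. -/
noncomputable def controlTransform (ω : Set Torus) (T : ℝ) (u : ℝ × Torus → ℂ) (z : ℂ) : ℂ :=
  ∫ q, extendControl ω u q * pole q / (z - pole q) ∂cylinderMeasure T

section
variable {ω : Set Torus} {T : ℝ} {u : ℝ × Torus → ℂ}

theorem IsControl.integrable_mul_pole (hω : IsOpen ω) (hu : IsControl ω T u) :
    Integrable (fun q => extendControl ω u q * pole q) (cylinderMeasure T) := by
  simpa using integrable_mul_pow (hu.integrable_extendControl hω)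
    continuous_pole.aestronglyMeasurable (ae_norm_pole_le T) 1

theorem IsControl.differentiableOn_controlTransform (hω : IsOpen ω) (hu : IsControl ω T u) :
    DifferentiableOn ℂ (controlTransform ω T u) (poleSet ω T)ᶜ := by
  refine differentiableOn_cauchyTransform (hu.integrable_mul_pole hω)
    continuous_pole.aestronglyMeasurable (isClosed_poleSet ω T) ?_
  filter_upwards [ae_mem_Icc T] with q hq h
  exact mem_image_of_mem _ ⟨hq, subset_closure (extendControl_ne_zero (left_ne_zero_of_mul h))⟩

theorem IsControl.norm_moment_le (hω : IsOpen ω) (hu : IsControl ω T u) (n : ℕ) :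
    ‖∫ q, extendControl ω u q * pole q ^ (n + 1) ∂cylinderMeasure T‖
      ≤ ∫ q, ‖extendControl ω u q * pole q‖ ∂cylinderMeasure T := by
  simpa [pow_succ', mul_assoc] using
    norm_integral_mul_pow_le (hu.integrable_mul_pole hω) (ae_norm_pole_le T) n

/-- The expansion of the transform at infinity. -/
theorem IsControl.hasSum_controlTransform (hω : IsOpen ω) (hu : IsControl ω T u) {z : ℂ}
    (hz : 1 < ‖z‖) :
    HasSum (fun n : ℕ =>
      (∫ q, extendControl ω u q * pole q ^ (n + 1) ∂cylinderMeasure T) * z⁻¹ ^ (n + 1))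
      (controlTransform ω T u z) := by
  have hz0 : z ≠ 0 := norm_pos_iff.mp (one_pos.trans hz)
  have hz1 : 1 * ‖z⁻¹‖ < 1 := by
    rw [one_mul, norm_inv]
    exact inv_lt_one_of_one_lt₀ hz
  have h := (hasSum_integral_geometric (hu.integrable_mul_pole hω)
    continuous_pole.aestronglyMeasurable zero_le_one (ae_norm_pole_le T) hz1).mul_left z⁻¹
  have heq : z⁻¹ * ∫ q, extendControl ω u q * pole q / (1 - pole q * z⁻¹) ∂cylinderMeasure T
      = controlTransform ω T u z := by
    rw [← integral_const_mul]
    refine integral_congr_ae (Eventually.of_forall fun q => ?_)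
    simp only
    rw [mul_div_left_comm, inv_eq_one_div, div_div, mul_sub, mul_one, mul_left_comm,
      mul_one_div_cancel hz0, mul_one, mul_one_div]
  rw [heq] at h
  refine h.congr_fun fun n => ?_
  rw [pow_succ' z⁻¹, mul_left_comm]
  simp only [pow_succ', mul_assoc]

/-- Near `0`, the transform of a control steering `f₀` to `0` is `f₀`. -/
theorem IsControl.controlTransform_eq_onDisk (hω : IsOpen ω) (hT : 0 < T) {f₀ : L2}
    (hu : IsControl ω T u) (hsol : solution ω f₀ u T = 0) {z : ℂ} (hz : ‖z‖ < Real.exp (-T)) :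
    onDisk f₀ z = controlTransform ω T u z := by
  have hz1 : Real.exp T * ‖z‖ < 1 := by
    have := mul_lt_mul_of_pos_left hz (Real.exp_pos T)
    rwa [← Real.exp_add, add_neg_cancel, Real.exp_zero] at this
  have h := (hasSum_integral_geometric (g := fun q => (pole q)⁻¹) (hu.integrable_extendControl hω)
    (continuous_pole.inv₀ pole_ne_zero).aestronglyMeasurable (Real.exp_nonneg T)
    (ae_norm_pole_inv_le T) hz1).neg
  rw [onDisk]
  have heq : -∫ q, extendControl ω u q / (1 - (pole q)⁻¹ * z) ∂cylinderMeasure T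
      = controlTransform ω T u z := by
    rw [← integral_neg]
    refine integral_congr_ae (Eventually.of_forall fun q => ?_)
    simp only
    rw [← mul_div_mul_right _ (1 - (pole q)⁻¹ * z) (pole_ne_zero q), sub_mul, one_mul,
      mul_right_comm, inv_mul_cancel₀ (pole_ne_zero q), one_mul, ← div_neg, neg_sub]
  rw [← heq, ← h.tsum_eq]
  refine tsum_congr fun n => ?_
  rw [fourierCoeff_eq_of_solution_eq_zero hω hT hu hsol, neg_mul]

theorem differentiableOn_onDisk (f : L2) : DifferentiableOn ℂ (onDisk f) (Metric.ball 0 1) :=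
  differentiableOn_tsum_mul_pow fun n => norm_fourierCoeff_le f (n : ℤ)

/-- The identity theorem on the star-shaped set of points of the disk that are not poles. -/
theorem IsControl.eqOn_onDisk_controlTransform (hω : IsOpen ω) (hT : 0 < T) {f₀ : L2}
    (hu : IsControl ω T u) (hsol : solution ω f₀ u T = 0) :
    EqOn (onDisk f₀) (controlTransform ω T u) (Metric.ball 0 1 ∩ (poleSet ω T)ᶜ) := by
  have hopen : IsOpen (Metric.ball (0 : ℂ) 1 ∩ (poleSet ω T)ᶜ) :=
    Metric.isOpen_ball.inter (isClosed_poleSet ω T).isOpen_compl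
  have h0 : (0 : ℂ) ∈ Metric.ball (0 : ℂ) 1 ∩ (poleSet ω T)ᶜ :=
    ⟨Metric.mem_ball_self one_pos, zero_notMem_poleSet ω T⟩
  refine AnalyticOnNhd.eqOn_of_preconnected_of_eventuallyEq
    (((differentiableOn_onDisk f₀).mono inter_subset_left).analyticOnNhd hopen)
    (((hu.differentiableOn_controlTransform hω).mono inter_subset_right).analyticOnNhd hopen)
    ((starConvex_ball_diff_poleSet ω T).isPathConnected h0).isConnected.isPreconnected h0 ?_
  filter_upwards [Metric.ball_mem_nhds (0 : ℂ) (Real.exp_pos (-T))] with z hz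
  exact hu.controlTransform_eq_onDisk hω hT hsol (mem_ball_zero_iff.mp hz)

end

/-- The extension of `f₀` to the sphere: `f₀` itself in the open disk, the transform of the control
outside of it, and `0` at infinity. At points of the circle in the closure of `ω` its values carry
no meaning. -/
noncomputable def sphereExtension (ω : Set Torus) (T : ℝ) (u : ℝ × Torus → ℂ) (f₀ : L2) :
    OnePoint ℂ → ℂ
  | none => 0
  | some z => if ‖z‖ < 1 then onDisk f₀ z else controlTransform ω T u z

theorem sphereExtension_infty (ω : Set Torus) (T : ℝ) (u : ℝ × Torus → ℂ) (f₀ : L2) :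
    sphereExtension ω T u f₀ OnePoint.infty = 0 := rfl

theorem sphereExtension_coe (ω : Set Torus) (T : ℝ) (u : ℝ × Torus → ℂ) (f₀ : L2) (z : ℂ) :
    sphereExtension ω T u f₀ (z : OnePoint ℂ)
      = if ‖z‖ < 1 then onDisk f₀ z else controlTransform ω T u z := rfl

theorem IsControl.holomorphicOnSphere_sphereExtension {ω : Set Torus} {T : ℝ}
    {u : ℝ × Torus → ℂ} (hω : IsOpen ω) (hT : 0 < T) {f₀ : L2} (hu : IsControl ω T u)
    (hsol : solution ω f₀ u T = 0) :
    HolomorphicOnSphere (sphereExtension ω T u f₀)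
      ((fun z : ℂ => (z : OnePoint ℂ)) '' closure (onCircle ω))ᶜ := by
  refine ⟨fun z hz => ?_, fun _ => ?_⟩
  · have hzc : z ∉ closure (onCircle ω) := fun h => hz (mem_image_of_mem _ h)
    by_cases h1 : ‖z‖ < 1
    · have hnhds := Metric.isOpen_ball.mem_nhds (mem_ball_zero_iff.mpr h1)
      refine ((differentiableOn_onDisk f₀).differentiableAt hnhds).congr_of_eventuallyEq ?_
      filter_upwards [hnhds] with w hw
      rw [sphereExtension_coe, if_pos (mem_ball_zero_iff.mp hw)]
    · have hzK : z ∈ (poleSet ω T)ᶜ := fun h =>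
        hzc (mem_closure_onCircle_of_mem_poleSet h (not_lt.mp h1))
      have hnhds := (isClosed_poleSet ω T).isOpen_compl.mem_nhds hzK
      refine ((hu.differentiableOn_controlTransform hω).differentiableAt
        hnhds).congr_of_eventuallyEq ?_
      filter_upwards [hnhds] with w hw
      rw [sphereExtension_coe]
      split_ifs with hw1
      · exact hu.eqOn_onDisk_controlTransform hω hT hsol ⟨mem_ball_zero_iff.mpr hw1, hw⟩
      · rfl
  · -- In the chart `w = 1/z` the extension is the power series `w ∑ aₙ wⁿ` of the moments.
    have hnhds := Metric.isOpen_ball.mem_nhds (Metric.mem_ball_self (x := (0 : ℂ)) one_pos)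
    refine (differentiableAt_id.mul ((differentiableOn_tsum_mul_pow
      (hu.norm_moment_le hω)).differentiableAt hnhds)).congr_of_eventuallyEq ?_
    filter_upwards [hnhds] with w hw
    rw [mem_ball_zero_iff] at hw
    by_cases hw0 : w = 0
    · simp [hw0, chartAtInfty, sphereExtension_infty]
    · have hw1 : 1 < ‖w⁻¹‖ := by
        rw [norm_inv]
        exact (one_lt_inv₀ (norm_pos_iff.mpr hw0)).mpr hw
      rw [chartAtInfty, if_neg hw0, sphereExtension_coe, if_neg (not_lt.mpr hw1.le),
        ← (hu.hasSum_controlTransform hω hw1).tsum_eq, Pi.mul_apply, id, ← tsum_mul_left]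
      refine tsum_congr fun n => ?_
      rw [inv_inv, pow_succ' w]
      ring

theorem IsControl.integrableOn_sq_deriv_sphereExtension {ω : Set Torus} {T : ℝ}
    {u : ℝ × Torus → ℂ} (hω : IsOpen ω) (hT : 0 < T) (f₀ : L2) (hu : IsControl ω T u) :
    IntegrableOn (fun z : ℂ => ‖deriv (fun w : ℂ => sphereExtension ω T u f₀ w) z‖ ^ 2)
      {z : ℂ | 1 < ‖z‖} := by
  refine integrableOn_sq_deriv_of_laurent (hu.norm_moment_le hω) (fun z hz => ?_)
    (hu.summable_moments hω hT)
  rw [sphereExtension_coe, if_neg (not_lt.mpr hz.le)]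
  exact hu.hasSum_controlTransform hω hz

end HalfHeat

theorem mainTheorem3 (ω : Set HalfHeat.Torus) (hω : IsOpen ω) (hstrict : ω ≠ Set.univ)
    (T : ℝ) (hT : 0 < T) (f₀ : HalfHeat.L2) (hf₀ : f₀ ∈ HalfHeat.nullControllable ω T) :
    ∃ F : OnePoint ℂ → ℂ,
      HalfHeat.HolomorphicOnSphere F
        (((fun z : ℂ => (z : OnePoint ℂ)) '' closure (HalfHeat.onCircle ω))ᶜ) ∧
      (∀ z : ℂ, ‖z‖ < 1 → F (z : OnePoint ℂ) = HalfHeat.onDisk f₀ z) ∧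
      F OnePoint.infty = 0 ∧
      MeasureTheory.IntegrableOn (fun z : ℂ => ‖deriv (fun w : ℂ => F (w : OnePoint ℂ)) z‖ ^ 2)
        {z : ℂ | 1 < ‖z‖} MeasureTheory.volume := by
  obtain ⟨-, u, hu, hsol⟩ := hf₀
  refine ⟨HalfHeat.sphereExtension ω T u f₀, hu.holomorphicOnSphere_sphereExtension hω hT hsol,
    fun z hz => ?_, HalfHeat.sphereExtension_infty ω T u f₀,
    hu.integrableOn_sq_deriv_sphereExtension hω hT f₀⟩
  rw [HalfHeat.sphereExtension_coe, if_pos hz]
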